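/- Let $a>0$, $\mu_1,\mu_2\in\mathbb R$, let $q=(x,y,z)$ be Cartesian coordinates on $\mathbb R^3$ with conjugate momenta $p=(p_x,p_y,p_z)$, put $o_1=(0,0,-a)$, $o_2=(0,0,a)$, and let $r_i$ be the distance to $o_i$. The integral map of the Euler two-center problem is $F=(H,L_z,G)$, where $$H=\tfrac12\|p\|^2-\frac{\mu_1}{r_1}-\frac{\mu_2}{r_2},\qquad L_z=xp_y-yp_x,$$ $$G=H+\tfrac12\bigl(L^2-a^2(p_x^2+p_y^2)\bigr)+a(z+a)\frac{\mu_1}{r_1}-a(z-a)\frac{\mu_2}{r_2},$$ and $L^2=\|q\times p\|^2$ is the squared angular momentum. A Kepler Hamiltonian is a function $\tfrac12\|p\|^2-\mu/r$, where $\mu\in\mathbb R$ is arbitrary and $r$ is the distance to an arbitrary point $o\in\mathbb R^3$; for $\mu=0$ it is the free Hamiltonian $\tfrac12\|p\|^2$, whatever $o$ is. Trajectories are those of the regularized Hamiltonian flow: a trajectory that collides with an attracting center is continued, with the same energy, by bouncing back in the direction from which it came. A scattering trajectory is a trajectory of positive energy whose position is unbounded both for $t\ge 0$ and for $t\le 0$.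 A Hamiltonian $H_r$ is called a reference Hamiltonian of $F$ if for every scattering trajectory $t\mapsto g^t_{H_r}(x)$ of $H_r$ the limits of $F(g^t_{H_r}(x))$ as $t\to+\infty$ and as $t\to-\infty$ exist and $$\lim_{t\to+\infty}F\bigl(g^t_{H_r}(x)\bigr)=\lim_{t\to-\infty}F\bigl(g^t_{H_r}(x)\bigr).$$ Theorem. A Kepler Hamiltonian is a reference Hamiltonian of $F$ if and only if it is one of the two Hamiltonians $$H_{r_1}=\tfrac12\|p\|^2-\frac{\mu_1-\mu_2}{r_1}\quad\text{and}\quad H_{r_2}=\tfrac12\|p\|^2-\frac{\mu_2-\mu_1}{r_2}.$$ In particular, the free Hamiltonian $\tfrac12\|p\|^2$ is a reference Hamiltonian of $F$ if and only if $\mu_1=\mu_2$. -/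

import Mathlib

open Filter Topology
open scoped ContDiff

namespace TwoCenter

/-- Configuration space, with Cartesian coordinates `q 0 = x`, `q 1 = y`, `q 2 = z`. -/
abbrev Config : Type := EuclideanSpace ℝ (Fin 3)

/-- Phase space: pairs `(q, p)` of a position and a momentum. -/
abbrev Phase : Type := Config × Config

noncomputable section

/-! ### Hamiltonians -/

/-- The free Hamiltonian `p² / 2`. -/
def freeHamiltonian (x : Phase) : ℝ := ‖x.2‖ ^ 2 / 2

/-- The Kepler Hamiltonian `p² / 2 - μ / r`, where `r` is the distance to the center `o`;
it is attractive for `0 < μ`, repulsive for `μ < 0`, and free for `μ = 0`. -/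
def keplerHamiltonian (o : Config) (μ : ℝ) (x : Phase) : ℝ :=
  ‖x.2‖ ^ 2 / 2 - μ / dist x.1 o

/-- The center `o₁ = (0, 0, -a)`. -/
def center₁ (a : ℝ) : Config := !₂[0, 0, -a]

/-- The center `o₂ = (0, 0, a)`. -/
def center₂ (a : ℝ) : Config := !₂[0, 0, a]

/-- The Hamiltonian `H = p² / 2 - μ₁ / r₁ - μ₂ / r₂` of the Euler two-center problem. -/
def eulerHamiltonian (a μ₁ μ₂ : ℝ) (x : Phase) : ℝ :=
  ‖x.2‖ ^ 2 / 2 - μ₁ / dist x.1 (center₁ a) - μ₂ / dist x.1 (center₂ a)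

/-! ### The integrals of the Euler problem -/

/-- `L_x = y p_z - z p_y`. -/
def angularX (x : Phase) : ℝ := x.1 1 * x.2 2 - x.1 2 * x.2 1

/-- `L_y = z p_x - x p_z`. -/
def angularY (x : Phase) : ℝ := x.1 2 * x.2 0 - x.1 0 * x.2 2

/-- `L_z = x p_y - y p_x`. -/
def angularZ (x : Phase) : ℝ := x.1 0 * x.2 1 - x.1 1 * x.2 0

/-- `L² = L_x² + L_y² + L_z²`. -/
def angularSq (x : Phase) : ℝ := angularX x ^ 2 + angularY x ^ 2 + angularZ x ^ 2

/-- The third integral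
`G = H + (L² - a² (p_x² + p_y²)) / 2 + a (z + a) μ₁ / r₁ - a (z - a) μ₂ / r₂`. -/
def thirdIntegral (a μ₁ μ₂ : ℝ) (x : Phase) : ℝ :=
  eulerHamiltonian a μ₁ μ₂ x
    + (angularSq x - a ^ 2 * (x.2 0 ^ 2 + x.2 1 ^ 2)) / 2
    + a * (x.1 2 + a) * (μ₁ / dist x.1 (center₁ a))
    - a * (x.1 2 - a) * (μ₂ / dist x.1 (center₂ a))

/-- The integral map `F = (H, L_z, G)` of the Euler problem. -/
def integralMap (a μ₁ μ₂ : ℝ) (x : Phase) : ℝ × ℝ × ℝ :=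
  (eulerHamiltonian a μ₁ μ₂ x, angularZ x, thirdIntegral a μ₁ μ₂ x)

/-! ### Trajectories -/

/-- The positions at which a Hamiltonian is singular. For the Kepler Hamiltonian this is its
center if `μ ≠ 0`, and there are no singular positions if `μ = 0`. -/
def singularPositions (H : Phase → ℝ) : Set Config :=
  {q | ∃ p : Config, ¬ ContDiffAt ℝ ∞ H (q, p)}

/-- The curve `γ = (q, p) : ℝ → Phase` is a trajectory of the regularized Hamiltonian flow of `H`.
Away from singular positions it solves Hamilton's equations
`q' = ∂H/∂p`, `p' = -∂H/∂q`. A collision with a singular position is regularized in the usual way,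
by the elastic bounce: the position is continuous, the energy after the collision is the
energy before it, and the particle leaves in the direction from which it arrived.
(The value of `p` at the very moment of a collision is irrelevant.) -/
structure IsTrajectory (H : Phase → ℝ) (γ : ℝ → Phase) : Prop where
  continuous_position : Continuous fun t => (γ t).1
  hamilton_position : ∀ t, (γ t).1 ∉ singularPositions H →
    HasDerivAt (fun s => (γ s).1) (gradient (fun p => H ((γ t).1, p)) (γ t).2) t
  hamilton_momentum : ∀ t, (γ t).1 ∉ singularPositions H →
    HasDerivAt (fun s => (γ s).2) (-gradient (fun q => H (q, (γ t).2)) (γ t).1) t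
  collisions_isolated : ∀ t, (γ t).1 ∈ singularPositions H →
    ∀ᶠ s in 𝓝[≠] t, (γ s).1 ∉ singularPositions H
  energy_constant : ∀ s t, (γ s).1 ∉ singularPositions H → (γ t).1 ∉ singularPositions H →
    H (γ s) = H (γ t)
  bounce : ∀ t, (γ t).1 ∈ singularPositions H →
    ∃ u : Config, Tendsto (fun s => ‖(γ s).1 - (γ t).1‖⁻¹ • ((γ s).1 - (γ t).1)) (𝓝[≠] t) (𝓝 u)

/-- A scattering trajectory: positive energy, and unbounded both as `t → +∞` and as `t → -∞`. -/
structure IsScatteringTrajectory (H : Phase → ℝ) (γ : ℝ → Phase) : Prop where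
  isTrajectory : IsTrajectory H γ
  energy_pos : ∀ t, (γ t).1 ∉ singularPositions H → 0 < H (γ t)
  unbounded_future : ¬ BddAbove ((fun t => ‖(γ t).1‖) '' Set.Ici 0)
  unbounded_past : ¬ BddAbove ((fun t => ‖(γ t).1‖) '' Set.Iic 0)

/-- `Hr` is a reference Hamiltonian for the integral map `F`: along every scattering trajectory
of `Hr`, the map `F` has limits as `t → +∞` and as `t → -∞`, and they coincide. -/
def IsReference {Y : Type*} [TopologicalSpace Y] (F : Phase → Y) (Hr : Phase → ℝ) : Prop :=
  ∀ γ : ℝ → Phase, IsScatteringTrajectory Hr γ →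
    ∃ c : Y, Tendsto (fun t => F (γ t)) atTop (𝓝 c) ∧ Tendsto (fun t => F (γ t)) atBot (𝓝 c)

end

end TwoCenter

namespace TwoCenter

/-! ### Calculus on the line with isolated exceptional times -/

/-! Far away the potentials vanish and the unit vectors pointing from any two fixed centers agree,
so the limit of `F` depends only on the limits of the momentum, of the angular momentum ℓ about the
Kepler center `o`, and of the axial component w of the direction. Sufficiency: if `o = (0, 0, b)`,
moving the base point of the angular momentum to `o` turns `G`, up to terms tending to 0, into a
constant of the Kepler motion plus (b² - a²)(p_x² + p_y²)/2 + b(p_x ℓ_y - p_y ℓ_x) + a(μ₁ - μ₂)w.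
The bracket in the middle term is c + μw, with c the conserved axial Runge–Lenz component
(`exists_rungeLenz_const`). Hence b² = a² and bμ + a(μ₁ - μ₂) = 0 suffice (`isReference_of_axis`);
these equations describe the two stated Hamiltonians. Necessity: for μ ≠ 0, comparing both ends of
three explicit hyperbolas forces `o` onto the axis and yields the same two equations
(`center_eq_of_isReference`). For μ = 0, one straight line along the axis, where w jumps from -1 to
1, forces μ₁ = μ₂. Collisions are isolated times, which the first calculus lemmas step across. -/

theorem monotone_of_eventually_deriv_nonneg {f f' : ℝ → ℝ} (hc : Continuous f)
    (h : ∀ t, ∀ᶠ s in 𝓝[>] t, HasDerivAt f (f' s) s ∧ 0 ≤ f' s) : Monotone f := by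
  have hloc : ∀ t, ∀ᶠ s in 𝓝[>] t, f t ≤ f s := by
    intro t
    obtain ⟨u, hu, hsub⟩ := mem_nhdsGT_iff_exists_Ioo_subset.1 (h t)
    filter_upwards [Ioo_mem_nhdsGT hu] with s hs
    have hmono : MonotoneOn f (Set.Icc t s) := by
      apply monotoneOn_of_deriv_nonneg (convex_Icc t s) hc.continuousOn
      · intro x hx
        rw [interior_Icc] at hx
        exact (hsub ⟨hx.1, hx.2.trans hs.2⟩).1.differentiableAt.differentiableWithinAt
      · intro x hx
        rw [interior_Icc] at hx
        have := hsub (show x ∈ Set.Ioo t u from ⟨hx.1, hx.2.trans hs.2⟩)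
        rw [this.1.deriv]
        exact this.2
    exact hmono (Set.left_mem_Icc.2 hs.1.le) (Set.right_mem_Icc.2 hs.1.le) hs.1.le
  intro s t hst
  have hclosed : IsClosed ({x | f s ≤ f x} ∩ Set.Icc s t) :=
    (isClosed_le continuous_const hc).inter isClosed_Icc
  -- Continuous induction: the closed set of good times contains `s` and can always be extended to
  -- the right.
  have hsub := hclosed.Icc_subset_of_forall_mem_nhdsWithin (le_refl (f s)) (fun x hx => by
    filter_upwards [hloc x] with y hy using le_trans hx.1 hy)
  exact hsub (Set.right_mem_Icc.2 hst)

theorem eq_of_eventually_deriv_zero {f : ℝ → ℝ} (hc : Continuous f)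
    (h : ∀ t, ∀ᶠ s in 𝓝[≠] t, HasDerivAt f 0 s) (s t : ℝ) : f s = f t := by
  have hgt : ∀ t, ∀ᶠ s in 𝓝[>] t, HasDerivAt f 0 s := fun t =>
    (h t).filter_mono (nhdsWithin_mono _ fun _ hx => ne_of_gt hx)
  have h1 : Monotone f := monotone_of_eventually_deriv_nonneg (f' := fun _ => 0) hc
    fun t => (hgt t).mono fun _ hs => ⟨hs, le_rfl⟩
  have h2 : Monotone (-f) := monotone_of_eventually_deriv_nonneg (f' := fun _ => 0) hc.neg
    fun t => (hgt t).mono fun _ hs => ⟨by simpa using hs.neg, le_rfl⟩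
  rcases le_total s t with hst | hst
  · exact le_antisymm (h1 hst) (neg_le_neg_iff.1 (h2 hst))
  · exact le_antisymm (neg_le_neg_iff.1 (h2 hst)) (h1 hst)

/-- A function with zero derivative off a set of isolated times, with a two-sided limit at each
of them, is constant off these times. -/
theorem exists_const_of_deriv_zero {f : ℝ → ℝ} {U : Set ℝ} (hU : ∀ t, ∀ᶠ s in 𝓝[≠] t, s ∈ U)
    (h : ∀ t ∈ U, HasDerivAt f 0 t)
    (hlim : ∀ t ∉ U, ∃ c, Tendsto f (𝓝[≠] t) (𝓝 c)) : ∃ c, ∀ t ∈ U, f t = c := by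
  classical
  choose! c hc using hlim
  -- Filling in the limits at the exceptional times gives a continuous function, to which the
  -- previous lemma applies.
  let g : ℝ → ℝ := fun t => if t ∈ U then f t else c t
  have hgf : ∀ t, g =ᶠ[𝓝[≠] t] f := fun t => (hU t).mono fun s hs => if_pos hs
  have hnear : ∀ t ∈ U, g =ᶠ[𝓝 t] f := by
    intro t ht
    have := hgf t
    rw [EventuallyEq, eventually_nhdsWithin_iff] at this
    filter_upwards [this] with s hs
    by_cases hst : s = t
    · subst hst; exact if_pos ht
    · exact hs hst
  have hcont : Continuous g := by
    rw [continuous_iff_continuousAt]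
    intro t
    by_cases ht : t ∈ U
    · exact (h t ht).continuousAt.congr (hnear t ht).symm
    · rw [continuousAt_iff_punctured_nhds, show g t = c t from if_neg ht]
      exact (hc t ht).congr' (hgf t).symm
  refine ⟨g 0, fun t ht => ?_⟩
  rw [← show g t = f t from if_pos ht]
  exact eq_of_eventually_deriv_zero hcont (fun x => (hU x).mono fun s hs =>
    (h s hs).congr_of_eventuallyEq (hnear s hs)) t 0

/-! ### Directions at infinity -/

theorem norm_direction_sub_le {V : Type*} [NormedAddCommGroup V] [NormedSpace ℝ V] (x y : V)
    (hx : x ≠ 0) (hy : y ≠ 0) :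
    ‖‖x‖⁻¹ • x - ‖y‖⁻¹ • y‖ ≤ 2 * ‖x - y‖ / ‖y‖ := by
  have hx' := norm_pos_iff.2 hx
  have hy' := norm_pos_iff.2 hy
  have e : ‖x‖⁻¹ • x - ‖y‖⁻¹ • y = ‖y‖⁻¹ • (x - y) + (‖x‖⁻¹ - ‖y‖⁻¹) • x := by module
  have h2 : ‖(‖x‖⁻¹ - ‖y‖⁻¹) • x‖ ≤ ‖x - y‖ / ‖y‖ := by
    rw [norm_smul, Real.norm_eq_abs, ← abs_of_pos hx', ← abs_mul, abs_of_pos hx',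
      show (‖x‖⁻¹ - ‖y‖⁻¹) * ‖x‖ = (‖y‖ - ‖x‖) / ‖y‖ by field_simp, abs_div, abs_of_pos hy']
    gcongr
    rw [norm_sub_rev]
    exact abs_norm_sub_norm_le y x
  rw [e]
  refine (norm_add_le _ _).trans ?_
  rw [norm_smul, norm_inv, norm_norm]
  calc _ ≤ ‖y‖⁻¹ * ‖x - y‖ + ‖x - y‖ / ‖y‖ := by gcongr
    _ = _ := by ring

theorem tendsto_norm_sub_atTop {α V : Type*} [NormedAddCommGroup V]
    {l : Filter α} {q : α → V} {o : V} (h : Tendsto (fun t => ‖q t - o‖) l atTop) (c : V) :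
    Tendsto (fun t => ‖q t - c‖) l atTop := by
  refine tendsto_atTop_mono (fun t => ?_) (tendsto_atTop_add_const_right l (-‖c - o‖) h)
  have := norm_add_le (q t - c) (c - o)
  rw [sub_add_sub_cancel] at this
  linarith

/-- Changing the base point moves the direction by O(1/r). -/
theorem tendsto_direction_sub {α V : Type*} [NormedAddCommGroup V] [NormedSpace ℝ V]
    {l : Filter α} {q : α → V} {o : V} (h : Tendsto (fun t => ‖q t - o‖) l atTop) (c : V) :
    Tendsto (fun t => ‖q t - c‖⁻¹ • (q t - c) - ‖q t - o‖⁻¹ • (q t - o)) l (𝓝 0) := by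
  rw [tendsto_zero_iff_norm_tendsto_zero]
  refine squeeze_zero' (Eventually.of_forall fun _ => norm_nonneg _)
    (g := fun t => 2 * ‖o - c‖ / ‖q t - o‖) ?_ (h.const_div_atTop _)
  filter_upwards [(tendsto_norm_sub_atTop h c).eventually_gt_atTop 0,
    h.eventually_gt_atTop 0] with t ht ht'
  have := norm_direction_sub_le (q t - c) (q t - o) (norm_pos_iff.1 ht) (norm_pos_iff.1 ht')
  rwa [sub_sub_sub_cancel_left] at this

/-! ### The Kepler Hamiltonian -/

theorem singularPositions_kepler_subset (o : Config) (μ : ℝ) :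
    singularPositions (keplerHamiltonian o μ) ⊆ {o} := by
  rintro q ⟨p, hp⟩
  by_contra hq
  apply hp
  have hq' : q ≠ o := hq
  unfold keplerHamiltonian
  refine ContDiffAt.sub ?_ ?_
  · exact (contDiffAt_snd.norm_sq ℝ).div_const 2
  · exact contDiffAt_const.div (contDiffAt_fst.dist ℝ contDiffAt_const hq') (dist_ne_zero.2 hq')

theorem mem_singularPositions_kepler (o : Config) {μ : ℝ} (hμ : μ ≠ 0) :
    o ∈ singularPositions (keplerHamiltonian o μ) := by
  refine ⟨0, fun h => ?_⟩
  have hc := h.continuousAt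
  let e : Config := EuclideanSpace.single 0 1
  have he : ‖e‖ = 1 := by simp [e]
  -- On a ray into `o` with zero momentum the energy is -μ/s, which is unbounded and contradicts
  -- continuity.
  have h1 : Tendsto (fun s : ℝ => ((o + s • e, 0) : Phase)) (𝓝[>] 0) (𝓝 (o, 0)) := by
    have : Continuous (fun s : ℝ => ((o + s • e, 0) : Phase)) := by fun_prop
    simpa using (this.tendsto 0).mono_left nhdsWithin_le_nhds
  have h2 := (hc.tendsto.comp h1).norm
  have h3 : Tendsto (fun s : ℝ => |μ| * s⁻¹) (𝓝[>] 0) atTop :=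
    tendsto_inv_nhdsGT_zero.const_mul_atTop (abs_pos.2 hμ)
  refine not_tendsto_nhds_of_tendsto_atTop h3 _ (h2.congr' ?_)
  filter_upwards [self_mem_nhdsWithin] with s hs
  have hs' : 0 < s := hs
  simp [keplerHamiltonian, norm_smul, he, abs_of_pos hs', div_eq_mul_inv]

theorem gradient_kepler_momentum (o : Config) (μ : ℝ) (q p : Config) :
    gradient (fun p => keplerHamiltonian o μ (q, p)) p = p := by
  apply HasGradientAt.gradient
  rw [hasGradientAt_iff_hasFDerivAt]
  unfold keplerHamiltonian
  have h := (((hasStrictFDerivAt_norm_sq p).hasFDerivAt).mul_const (1/2 : ℝ)).sub_const (μ / dist q o)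
  simp only [div_eq_mul_inv, one_mul] at h ⊢
  refine h.congr_fderiv ?_
  ext v
  simp

theorem gradient_kepler_position (o : Config) (μ : ℝ) (q p : Config) (h : μ ≠ 0 → q ≠ o) :
    gradient (fun q => keplerHamiltonian o μ (q, p)) q = (μ / ‖q - o‖ ^ 3) • (q - o) := by
  apply HasGradientAt.gradient
  rw [hasGradientAt_iff_hasFDerivAt]
  unfold keplerHamiltonian
  by_cases hμ : μ = 0
  · subst hμ
    simpa using hasFDerivAt_const (‖p‖ ^ 2 / 2) q
  have hq := h hμ
  have hr : 0 < ‖q - o‖ := norm_pos_iff.2 (sub_ne_zero.2 hq)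
  have h1 : HasFDerivAt (fun q : Config => ‖q - o‖ ^ 2) (2 • innerSL ℝ (q - o)) q := by
    exact (hasStrictFDerivAt_norm_sq (q - o)).hasFDerivAt.comp q ((hasFDerivAt_id q).sub_const o)
  have h2 := h1.sqrt (by positivity)
  simp only [Real.sqrt_sq (norm_nonneg _)] at h2
  have h3 := ((hasDerivAt_inv hr.ne').comp_hasFDerivAt q h2).const_mul μ |>.const_sub (‖p‖ ^ 2 / 2)
  simp only [dist_eq_norm, div_eq_mul_inv]
  refine h3.congr_fderiv ?_
  ext v
  simp [-map_sub]
  field_simp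

/-! ### Kepler trajectories and their conserved quantities -/

section Trajectory

variable {o : Config} {μ : ℝ} {γ : ℝ → Phase}

theorem position_eq_center {q : Config} (h : q ∈ singularPositions (keplerHamiltonian o μ)) :
    q = o :=
  singularPositions_kepler_subset o μ h

theorem position_ne_center {q : Config} (h : q ∉ singularPositions (keplerHamiltonian o μ))
    (hμ : μ ≠ 0) : q ≠ o := by
  rintro rfl
  exact h (mem_singularPositions_kepler q hμ)

theorem eventually_regular (h : IsTrajectory (keplerHamiltonian o μ) γ) (t : ℝ) :
    ∀ᶠ s in 𝓝[≠] t, (γ s).1 ∉ singularPositions (keplerHamiltonian o μ) := by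
  by_cases ht : (γ t).1 ∈ singularPositions (keplerHamiltonian o μ)
  · exact h.collisions_isolated t ht
  · have hcl : IsClosed (singularPositions (keplerHamiltonian o μ)) := by
      rcases Set.subset_singleton_iff_eq.1 (singularPositions_kepler_subset o μ) with e | e <;>
        rw [e]
      · exact isClosed_empty
      · exact isClosed_singleton
    exact (h.continuous_position.continuousAt.eventually
      (hcl.isOpen_compl.mem_nhds ht)).filter_mono nhdsWithin_le_nhds

theorem exists_regular (h : IsTrajectory (keplerHamiltonian o μ) γ) :
    ∃ t, (γ t).1 ∉ singularPositions (keplerHamiltonian o μ) :=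
  (eventually_regular h 0).exists

theorem hasDerivAt_position (h : IsTrajectory (keplerHamiltonian o μ) γ) {t : ℝ}
    (ht : (γ t).1 ∉ singularPositions (keplerHamiltonian o μ)) (i : Fin 3) :
    HasDerivAt (fun s => (γ s).1 i) ((γ t).2 i) t := by
  have h1 := h.hamilton_position t ht
  rw [gradient_kepler_momentum] at h1
  exact (EuclideanSpace.proj i : Config →L[ℝ] ℝ).hasFDerivAt.comp_hasDerivAt t h1

theorem hasDerivAt_momentum (h : IsTrajectory (keplerHamiltonian o μ) γ) {t : ℝ}
    (ht : (γ t).1 ∉ singularPositions (keplerHamiltonian o μ)) (i : Fin 3) :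
    HasDerivAt (fun s => (γ s).2 i)
      (-(μ / ‖(γ t).1 - o‖ ^ 3 * ((γ t).1 i - o i))) t := by
  have h1 := h.hamilton_momentum t ht
  rw [gradient_kepler_position _ _ _ _ (position_ne_center ht)] at h1
  exact (EuclideanSpace.proj i : Config →L[ℝ] ℝ).hasFDerivAt.comp_hasDerivAt t h1

theorem exists_energy (h : IsTrajectory (keplerHamiltonian o μ) γ) :
    ∃ E, ∀ t, (γ t).1 ∉ singularPositions (keplerHamiltonian o μ) →
      keplerHamiltonian o μ (γ t) = E := by
  obtain ⟨t₀, ht₀⟩ := exists_regular h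
  exact ⟨_, fun t ht => h.energy_constant t t₀ ht ht₀⟩

/-- The momentum blows up at a collision, but r‖p‖ tends to 0 there; this identity also bounds r‖p‖
in terms of r. -/
theorem sq_norm_mul_norm {E : ℝ} {x : Phase} (hμ : μ ≠ 0 → x.1 ≠ o)
    (hE : keplerHamiltonian o μ x = E) :
    (‖x.1 - o‖ * ‖x.2‖) ^ 2 = 2 * E * ‖x.1 - o‖ ^ 2 + 2 * μ * ‖x.1 - o‖ := by
  rw [← hE, keplerHamiltonian, dist_eq_norm]
  by_cases h0 : μ = 0
  · subst h0; simp; ring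
  · have : ‖x.1 - o‖ ≠ 0 := norm_ne_zero_iff.2 (sub_ne_zero.2 (hμ h0))
    field_simp
    ring

theorem abs_coord_mul_le (x y : Config) (i j : Fin 3) : |x i * y j| ≤ ‖x‖ * ‖y‖ := by
  rw [abs_mul]
  gcongr
  · exact PiLp.norm_apply_le x i
  · exact PiLp.norm_apply_le y j

theorem continuous_coord_mul (h : IsTrajectory (keplerHamiltonian o μ) γ) (i j : Fin 3) :
    Continuous fun t => ((γ t).1 i - o i) * (γ t).2 j := by
  rw [continuous_iff_continuousAt]
  intro t
  by_cases ht : (γ t).1 ∈ singularPositions (keplerHamiltonian o μ)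
  · obtain ⟨E, hE⟩ := exists_energy h
    have hto := position_eq_center ht
    have hr : Tendsto (fun s => ‖(γ s).1 - o‖) (𝓝[≠] t) (𝓝 0) := by
      have : Continuous fun s => ‖(γ s).1 - o‖ := (h.continuous_position.sub continuous_const).norm
      simpa [hto] using (this.tendsto t).mono_left nhdsWithin_le_nhds
    have hlim : Tendsto (fun s => √(2 * E * ‖(γ s).1 - o‖ ^ 2 + 2 * μ * ‖(γ s).1 - o‖))
        (𝓝[≠] t) (𝓝 0) := by
      simpa using (((hr.pow 2).const_mul (2 * E)).add (hr.const_mul (2 * μ))).sqrt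
    rw [continuousAt_iff_punctured_nhds, hto, sub_self, zero_mul]
    refine squeeze_zero_norm' ?_ hlim
    filter_upwards [h.collisions_isolated t ht] with s hs
    rw [← sq_norm_mul_norm (position_ne_center hs) (hE s hs), Real.sqrt_sq (by positivity)]
    exact abs_coord_mul_le ((γ s).1 - o) (γ s).2 i j
  · exact (((hasDerivAt_position h ht i).sub_const _).mul (hasDerivAt_momentum h ht j)).continuousAt

/-- Conservation of the angular momentum about the center. -/
theorem angular_const (h : IsTrajectory (keplerHamiltonian o μ) γ) (i j : Fin 3) (s t : ℝ) :
    ((γ s).1 i - o i) * (γ s).2 j - ((γ s).1 j - o j) * (γ s).2 i =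
      ((γ t).1 i - o i) * (γ t).2 j - ((γ t).1 j - o j) * (γ t).2 i := by
  refine eq_of_eventually_deriv_zero
    (f := fun s => ((γ s).1 i - o i) * (γ s).2 j - ((γ s).1 j - o j) * (γ s).2 i)
    ((continuous_coord_mul h i j).sub (continuous_coord_mul h j i)) (fun t => ?_) s t
  filter_upwards [eventually_regular h t] with s hs
  refine ((((hasDerivAt_position h hs i).sub_const (o i)).mul (hasDerivAt_momentum h hs j)).sub
    (((hasDerivAt_position h hs j).sub_const (o j)).mul
      (hasDerivAt_momentum h hs i))).congr_deriv ?_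
  ring

theorem norm_sq_coord (x : Config) : ‖x‖ ^ 2 = x 0 ^ 2 + x 1 ^ 2 + x 2 ^ 2 := by
  rw [EuclideanSpace.real_norm_sq_eq, Fin.sum_univ_three]

/-- The radial moment `(q - o) · p` grows at least linearly. -/
theorem radialMoment_sub_monotone (h : IsTrajectory (keplerHamiltonian o μ) γ) {E : ℝ}
    (hE : ∀ t, (γ t).1 ∉ singularPositions (keplerHamiltonian o μ) →
      keplerHamiltonian o μ (γ t) = E) :
    Monotone fun t => ((γ t).1 0 - o 0) * (γ t).2 0 + ((γ t).1 1 - o 1) * (γ t).2 1 +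
      ((γ t).1 2 - o 2) * (γ t).2 2 - E * t := by
  -- The derivative of (q - o) · p is ‖p‖² - μ/r = E + ‖p‖²/2.
  refine monotone_of_eventually_deriv_nonneg (f' := fun t => ‖(γ t).2‖ ^ 2 / 2)
    ((((continuous_coord_mul h 0 0).add (continuous_coord_mul h 1 1)).add
      (continuous_coord_mul h 2 2)).sub (by fun_prop)) (fun t => ?_)
  have hgt := (eventually_regular h t).filter_mono
    (nhdsWithin_mono t fun s (hs : t < s) => ne_of_gt hs)
  filter_upwards [hgt] with s hs
  refine ⟨?_, by positivity⟩
  have hd := fun i => ((hasDerivAt_position h hs i).sub_const (o i)).mul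
    (hasDerivAt_momentum h hs i)
  refine ((((hd 0).add (hd 1)).add (hd 2)).sub ((hasDerivAt_id s).const_mul E)).congr_deriv ?_
  have hp := norm_sq_coord (γ s).2
  have hq := norm_sq_coord ((γ s).1 - o)
  simp only [PiLp.sub_apply] at hq
  have hEs : ‖(γ s).2‖ ^ 2 / 2 - μ / ‖(γ s).1 - o‖ = E := by
    rw [← hE s hs, keplerHamiltonian, dist_eq_norm]
  have hr : μ / ‖(γ s).1 - o‖ ^ 3 * ‖(γ s).1 - o‖ ^ 2 = μ / ‖(γ s).1 - o‖ := by
    by_cases h0 : μ = 0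
    · simp [h0]
    · have : ‖(γ s).1 - o‖ ≠ 0 := norm_ne_zero_iff.2 (sub_ne_zero.2 (position_ne_center hs h0))
      field_simp
  rw [hq] at hr
  linear_combination hEs - hr - hp

theorem tendsto_abs_radialMoment (h : IsScatteringTrajectory (keplerHamiltonian o μ) γ)
    {l : Filter ℝ} (hl : l = atTop ∨ l = atBot) :
    Tendsto (fun t => |((γ t).1 0 - o 0) * (γ t).2 0 + ((γ t).1 1 - o 1) * (γ t).2 1 +
      ((γ t).1 2 - o 2) * (γ t).2 2|) l atTop := by
  have h' := h.isTrajectory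
  obtain ⟨E, hE⟩ := exists_energy h'
  obtain ⟨t₀, ht₀⟩ := exists_regular h'
  have hpos : 0 < E := hE t₀ ht₀ ▸ h.energy_pos t₀ ht₀
  have hm := radialMoment_sub_monotone h' hE
  set D : ℝ → ℝ := fun t => ((γ t).1 0 - o 0) * (γ t).2 0 + ((γ t).1 1 - o 1) * (γ t).2 1 +
      ((γ t).1 2 - o 2) * (γ t).2 2 with hD
  have hm' : ∀ s t, s ≤ t → D s - E * s ≤ D t - E * t := fun s t hst => hm hst
  rcases hl with rfl | rfl
  · refine tendsto_abs_atTop_atTop.comp (tendsto_atTop_mono' _ ?_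
      (tendsto_atTop_add_const_right _ (D 0) (tendsto_id.const_mul_atTop hpos)))
    filter_upwards [eventually_ge_atTop 0] with t ht
    have := hm' 0 t ht
    simp only [id]
    linarith
  · refine tendsto_abs_atBot_atTop.comp (tendsto_atBot_mono' _ ?_
      (tendsto_atBot_add_const_right _ (D 0) (tendsto_id.const_mul_atBot hpos)))
    filter_upwards [eventually_le_atBot 0] with t ht
    have := hm' t 0 ht
    simp only [id]
    linarith

/-- The radial moment is at most 3r‖p‖, which energy conservation bounds as long as r is bounded;
since the moment diverges, so does r. -/
theorem tendsto_norm_position (h : IsScatteringTrajectory (keplerHamiltonian o μ) γ)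
    {l : Filter ℝ} (hl : l = atTop ∨ l = atBot) :
    Tendsto (fun t => ‖(γ t).1 - o‖) l atTop := by
  have hD := tendsto_abs_radialMoment h hl
  have h' := h.isTrajectory
  obtain ⟨E, hE⟩ := exists_energy h'
  rw [tendsto_atTop]
  intro R
  filter_upwards [hD.eventually_gt_atTop (3 * √(2 * |E| * R ^ 2 + 2 * |μ| * |R|))] with t ht
  by_contra! hlt
  refine ht.not_ge ?_
  have hle : |((γ t).1 0 - o 0) * (γ t).2 0 + ((γ t).1 1 - o 1) * (γ t).2 1 +
      ((γ t).1 2 - o 2) * (γ t).2 2| ≤ 3 * (‖(γ t).1 - o‖ * ‖(γ t).2‖) := by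
    have hc := fun i => abs_coord_mul_le ((γ t).1 - o) (γ t).2 i i
    simp only [PiLp.sub_apply] at hc
    refine (abs_add_le _ _).trans ?_
    linarith [abs_add_le (((γ t).1 0 - o 0) * (γ t).2 0) (((γ t).1 1 - o 1) * (γ t).2 1),
      hc 0, hc 1, hc 2]
  refine hle.trans (mul_le_mul_of_nonneg_left (Real.le_sqrt_of_sq_le ?_) (by norm_num))
  -- At a collision `p` is arbitrary, but q - o = 0 makes the product vanish.
  by_cases ht : (γ t).1 ∈ singularPositions (keplerHamiltonian o μ)
  · rw [position_eq_center ht]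
    simp
    positivity
  · rw [sq_norm_mul_norm (position_ne_center ht) (hE t ht)]
    have hR : R = |R| := (abs_of_pos ((norm_nonneg _).trans_lt hlt)).symm
    rw [← hR]
    have h1 := norm_nonneg ((γ t).1 - o)
    gcongr
    · exact le_abs_self E
    · exact le_abs_self μ

/-- Conservation of the third component of the Laplace–Runge–Lenz vector, also through
collisions. -/
theorem exists_rungeLenz_const (h : IsTrajectory (keplerHamiltonian o μ) γ) :
    ∃ c, ∀ t, (γ t).1 ∉ singularPositions (keplerHamiltonian o μ) →
      (γ t).2 0 * (((γ t).1 2 - o 2) * (γ t).2 0 - ((γ t).1 0 - o 0) * (γ t).2 2) -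
        (γ t).2 1 * (((γ t).1 1 - o 1) * (γ t).2 2 - ((γ t).1 2 - o 2) * (γ t).2 1) -
          μ * (((γ t).1 2 - o 2) / ‖(γ t).1 - o‖) = c := by
  refine exists_const_of_deriv_zero (U := {t | (γ t).1 ∉ singularPositions (keplerHamiltonian o μ)})
    (f := fun t => (γ t).2 0 * (((γ t).1 2 - o 2) * (γ t).2 0 - ((γ t).1 0 - o 0) * (γ t).2 2) -
        (γ t).2 1 * (((γ t).1 1 - o 1) * (γ t).2 2 - ((γ t).1 2 - o 2) * (γ t).2 1) -
          μ * (((γ t).1 2 - o 2) / ‖(γ t).1 - o‖)) (eventually_regular h) ?_ ?_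
  · intro t ht
    have hQ := fun i => (hasDerivAt_position h ht i).sub_const (o i)
    have hP := fun i => hasDerivAt_momentum h ht i
    have hB := ((hP 0).mul (((hQ 2).mul (hP 0)).sub ((hQ 0).mul (hP 2)))).sub
      ((hP 1).mul (((hQ 1).mul (hP 2)).sub ((hQ 2).mul (hP 1))))
    by_cases h0 : μ = 0
    · subst h0
      simp only [zero_mul, sub_zero]
      refine hB.congr_deriv ?_
      simp
      ring
    have hr : 0 < ‖(γ t).1 - o‖ := norm_pos_iff.2 (sub_ne_zero.2 (position_ne_center ht h0))
    have hq : ∀ s, ‖(γ s).1 - o‖ ^ 2 =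
        ((γ s).1 0 - o 0) ^ 2 + ((γ s).1 1 - o 1) ^ 2 + ((γ s).1 2 - o 2) ^ 2 := fun s => by
      simpa using norm_sq_coord ((γ s).1 - o)
    have hn : HasDerivAt (fun s => ‖(γ s).1 - o‖)
        ((((γ t).1 0 - o 0) * (γ t).2 0 + ((γ t).1 1 - o 1) * (γ t).2 1 +
          ((γ t).1 2 - o 2) * (γ t).2 2) / ‖(γ t).1 - o‖) t := by
      have h1 := ((((hQ 0).pow 2).add ((hQ 1).pow 2)).add ((hQ 2).pow 2)).sqrt (by
        have := hq t
        simp only [Pi.add_apply, Pi.pow_apply]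
        rw [← this]
        positivity)
      have e : (fun s => ‖(γ s).1 - o‖) = fun s => √(((γ s).1 0 - o 0) ^ 2 +
          ((γ s).1 1 - o 1) ^ 2 + ((γ s).1 2 - o 2) ^ 2) := by
        funext s
        rw [← hq, Real.sqrt_sq (norm_nonneg _)]
      rw [e]
      refine h1.congr_deriv ?_
      simp only [Pi.add_apply, Pi.pow_apply]
      rw [← hq t, Real.sqrt_sq (norm_nonneg _)]
      field_simp
      simp
    refine (hB.sub (((hQ 2).div hn hr.ne').const_mul μ)).congr_deriv ?_
    simp only [Pi.sub_apply, Pi.mul_apply]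
    have hqt := hq t
    field_simp
    rw [hqt]
    ring
  · intro t ht
    have ht' : (γ t).1 ∈ singularPositions (keplerHamiltonian o μ) := not_not.1 ht
    obtain ⟨u, hu⟩ := h.bounce t ht'
    have hto := position_eq_center ht'
    rw [hto] at hu
    have hu2 := ((EuclideanSpace.proj 2 : Config →L[ℝ] ℝ).continuous.tendsto u).comp hu
    refine ⟨-(μ * u 2), (hu2.const_mul μ).neg.congr fun s => ?_⟩
    -- A trajectory that collides has zero angular momentum at all times, so only -μ times the axial
    -- direction component remains, and the bounce condition gives it a two-sided limit.
    have h1 := angular_const h 2 0 s t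
    have h2 := angular_const h 1 2 s t
    simp only [hto, sub_self, zero_mul] at h1 h2
    rw [h1, h2]
    simp [div_eq_inv_mul]

end Trajectory

/-! ### Sufficiency -/

theorem tendsto_coord_direction_sub {α : Type*} {l : Filter α} {q : α → Config} {o : Config}
    (h : Tendsto (fun t => ‖q t - o‖) l atTop) (c : Config) (i : Fin 3) :
    Tendsto (fun t => (q t i - c i) / ‖q t - c‖ - (q t i - o i) / ‖q t - o‖) l (𝓝 0) := by
  have := ((EuclideanSpace.proj i : Config →L[ℝ] ℝ).continuous.tendsto 0).comp
    (tendsto_direction_sub h c)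
  simpa [Function.comp_def, div_eq_inv_mul] using this

/-- Exhibits the potential terms as axial components of unit vectors, which makes their asymptotics
visible. -/
theorem thirdIntegral_eq (a μ₁ μ₂ : ℝ) (x : Phase) :
    thirdIntegral a μ₁ μ₂ x = eulerHamiltonian a μ₁ μ₂ x
      + (angularSq x - a ^ 2 * (x.2 0 ^ 2 + x.2 1 ^ 2)) / 2
      + a * μ₁ * ((x.1 2 - center₁ a 2) / ‖x.1 - center₁ a‖)
      - a * μ₂ * ((x.1 2 - center₂ a 2) / ‖x.1 - center₂ a‖) := by
  simp only [thirdIntegral, dist_eq_norm]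
  simp [center₁, center₂]
  ring

theorem isReference_of_axis {a μ₁ μ₂ μ b : ℝ} (hb : b ^ 2 = a ^ 2)
    (hμ : b * μ + a * (μ₁ - μ₂) = 0) :
    IsReference (integralMap a μ₁ μ₂) (keplerHamiltonian !₂[0, 0, b] μ) := by
  intro γ h
  have h' := h.isTrajectory
  obtain ⟨E, hE⟩ := exists_energy h'
  obtain ⟨c, hc⟩ := exists_rungeLenz_const h'
  set o : Config := !₂[0, 0, b] with ho
  have o0 : o 0 = 0 := by simp [ho]
  have o1 : o 1 = 0 := by simp [ho]
  have o2 : o 2 = b := by simp [ho]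
  set ℓ : Fin 3 → Fin 3 → ℝ := fun i j =>
    ((γ 0).1 i - o i) * (γ 0).2 j - ((γ 0).1 j - o j) * (γ 0).2 i with hℓ
  have hL : ∀ i j t, ((γ t).1 i - o i) * (γ t).2 j - ((γ t).1 j - o j) * (γ t).2 i = ℓ i j :=
    fun i j t => angular_const h' i j t 0
  have key : ∀ l : Filter ℝ, (l = atTop ∨ l = atBot) →
      Tendsto (fun t => integralMap a μ₁ μ₂ (γ t)) l
        (𝓝 (E, ℓ 0 1, E + (ℓ 0 1 ^ 2 + ℓ 1 2 ^ 2 + ℓ 2 0 ^ 2) / 2 + b * c)) := by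
    intro l hl
    have hr := tendsto_norm_position h hl
    have hreg : ∀ᶠ t in l, (γ t).1 ∉ singularPositions (keplerHamiltonian o μ) := by
      filter_upwards [hr.eventually_gt_atTop 0] with t ht hmem
      rw [position_eq_center hmem] at ht
      simp at ht
    have hH : Tendsto (fun t => eulerHamiltonian a μ₁ μ₂ (γ t)) l (𝓝 E) := by
      have h1 := (tendsto_norm_sub_atTop hr (center₁ a)).const_div_atTop μ₁
      have h2 := (tendsto_norm_sub_atTop hr (center₂ a)).const_div_atTop μ₂
      have h3 := (((hr.const_div_atTop μ).const_add E).sub h1).sub h2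
      simp only [add_zero, sub_zero] at h3
      refine h3.congr' ?_
      filter_upwards [hreg] with t ht
      rw [← hE t ht]
      simp only [eulerHamiltonian, keplerHamiltonian, dist_eq_norm]
      ring
    refine hH.prodMk_nhds (Tendsto.prodMk_nhds ?_ ?_)
    · refine tendsto_const_nhds.congr fun t => ?_
      rw [← hL 0 1 t, o0, o1, angularZ]
      ring
    -- Both directions may be replaced by the direction from `o`; what is then left is constant
    -- apart from `H`, because `hb` cancels the quadratic momentum terms and `hμ` the direction
    -- terms.
    · have h1 := (tendsto_coord_direction_sub hr (center₁ a) 2).const_mul (a * μ₁)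
      have h2 := (tendsto_coord_direction_sub hr (center₂ a) 2).const_mul (a * μ₂)
      have h3 := (((hH.add_const ((ℓ 0 1 ^ 2 + ℓ 1 2 ^ 2 + ℓ 2 0 ^ 2) / 2 + b * c)).add h1).sub h2)
      simp only [mul_zero, add_zero, sub_zero, ← add_assoc] at h3
      refine h3.congr' ?_
      filter_upwards [hreg] with t ht
      have e01 := hL 0 1 t
      have e12 := hL 1 2 t
      have e20 := hL 2 0 t
      have hct := hc t ht
      rw [thirdIntegral_eq, ← hct, ← e01, ← e12, ← e20, o0, o1, o2]
      simp only [angularSq, angularX, angularY, angularZ]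
      linear_combination (-((γ t).1 2 - b) / ‖(γ t).1 - o‖) * hμ
        - ((γ t).2 0 ^ 2 + (γ t).2 1 ^ 2) / 2 * hb
  exact ⟨_, key atTop (Or.inl rfl), key atBot (Or.inr rfl)⟩

/-! ### The limit of the integral map along a scattering asymptote -/

/-- The limit of `F` along a motion with momentum tending to `P`, third component of the direction
of `q - o` tending to `w`, and angular momentum about `o` tending to `Λ`. -/
noncomputable def asymptoticValue (a μ₁ μ₂ : ℝ) (o P : Config) (w : ℝ) (Λ : Fin 3 → Fin 3 → ℝ) :
    ℝ × ℝ × ℝ :=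
  (‖P‖ ^ 2 / 2, Λ 0 1 + (o 0 * P 1 - o 1 * P 0),
    ‖P‖ ^ 2 / 2 + ((Λ 1 2 + (o 1 * P 2 - o 2 * P 1)) ^ 2 + (Λ 2 0 + (o 2 * P 0 - o 0 * P 2)) ^ 2
      + (Λ 0 1 + (o 0 * P 1 - o 1 * P 0)) ^ 2 - a ^ 2 * (P 0 ^ 2 + P 1 ^ 2)) / 2
      + a * (μ₁ - μ₂) * w)

theorem tendsto_integralMap {α : Type*} {l : Filter α} {γ : α → Phase} {o P : Config} {w : ℝ}
    {Λ : Fin 3 → Fin 3 → ℝ} (a μ₁ μ₂ : ℝ) (hr : Tendsto (fun t => ‖(γ t).1 - o‖) l atTop)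
    (hP : Tendsto (fun t => (γ t).2) l (𝓝 P))
    (hw : Tendsto (fun t => ((γ t).1 2 - o 2) / ‖(γ t).1 - o‖) l (𝓝 w))
    (hΛ : ∀ i j, Tendsto (fun t => ((γ t).1 i - o i) * (γ t).2 j - ((γ t).1 j - o j) * (γ t).2 i)
      l (𝓝 (Λ i j))) :
    Tendsto (fun t => integralMap a μ₁ μ₂ (γ t)) l (𝓝 (asymptoticValue a μ₁ μ₂ o P w Λ)) := by
  have hPi : ∀ i, Tendsto (fun t => (γ t).2 i) l (𝓝 (P i)) := fun i =>
    ((EuclideanSpace.proj i : Config →L[ℝ] ℝ).continuous.tendsto P).comp hP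
  have hH : Tendsto (fun t => eulerHamiltonian a μ₁ μ₂ (γ t)) l (𝓝 (‖P‖ ^ 2 / 2)) := by
    have h1 := (tendsto_norm_sub_atTop hr (center₁ a)).const_div_atTop μ₁
    have h2 := (tendsto_norm_sub_atTop hr (center₂ a)).const_div_atTop μ₂
    have h3 := (((hP.norm.pow 2).div_const 2).sub h1).sub h2
    simpa only [sub_zero, eulerHamiltonian, dist_eq_norm] using h3
  have hL : ∀ i j, Tendsto (fun t => (γ t).1 i * (γ t).2 j - (γ t).1 j * (γ t).2 i) l
      (𝓝 (Λ i j + (o i * P j - o j * P i))) := by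
    intro i j
    refine ((hΛ i j).add (((hPi j).const_mul (o i)).sub ((hPi i).const_mul (o j)))).congr
      fun t => ?_
    ring
  have hwc : ∀ c : Config, Tendsto (fun t => ((γ t).1 2 - c 2) / ‖(γ t).1 - c‖) l (𝓝 w) := by
    intro c
    simpa using (tendsto_coord_direction_sub hr c 2).add hw
  refine hH.prodMk_nhds ((hL 0 1).prodMk_nhds ?_)
  simp only [thirdIntegral_eq, angularSq, angularX, angularY, angularZ]
  have h := ((hH.add ((((((hL 1 2).pow 2).add ((hL 2 0).pow 2)).add ((hL 0 1).pow 2)).sub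
    ((((hPi 0).pow 2).add ((hPi 1).pow 2)).const_mul (a ^ 2))).div_const 2)).add
    ((hwc (center₁ a)).const_mul (a * μ₁))).sub ((hwc (center₂ a)).const_mul (a * μ₂))
  convert h using 2
  ring

/-! ### Hyperbolic Kepler motion of eccentricity `5 / 3` and energy `1 / 2` -/

noncomputable section

/-- The distance to the center, as a function of the hyperbolic anomaly. -/
def hyperbolaRadius (μ u : ℝ) : ℝ := 5 / 3 * |μ| * Real.cosh u - μ

/-- Kepler's equation. -/
def hyperbolaTime (μ u : ℝ) : ℝ := 5 / 3 * |μ| * Real.sinh u - μ * u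

/-- Here 2/3 is the eccentricity minus 1, and cosh u ≥ 1 absorbs the term μ for either sign. -/
theorem hyperbolaRadius_ge (μ u : ℝ) : 2 / 3 * |μ| * Real.cosh u ≤ hyperbolaRadius μ u := by
  have h1 := Real.one_le_cosh u
  have h2 := le_abs_self μ
  have h3 := abs_nonneg μ
  unfold hyperbolaRadius
  nlinarith

theorem hyperbolaRadius_pos {μ : ℝ} (hμ : μ ≠ 0) (u : ℝ) : 0 < hyperbolaRadius μ u :=
  lt_of_lt_of_le (by have := abs_pos.2 hμ; have := Real.cosh_pos u; positivity)
    (hyperbolaRadius_ge μ u)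

theorem hasDerivAt_hyperbolaTime (μ u : ℝ) :
    HasDerivAt (hyperbolaTime μ) (hyperbolaRadius μ u) u := by
  refine (((Real.hasDerivAt_sinh u).const_mul (5 / 3 * |μ|)).sub
    ((hasDerivAt_id u).const_mul μ)).congr_deriv ?_
  simp [hyperbolaRadius]

theorem hyperbolaTime_strictMono {μ : ℝ} (hμ : μ ≠ 0) : StrictMono (hyperbolaTime μ) :=
  strictMono_of_hasDerivAt_pos (hasDerivAt_hyperbolaTime μ) (hyperbolaRadius_pos hμ)

theorem hyperbolaTime_surjective {μ : ℝ} (hμ : μ ≠ 0) : Function.Surjective (hyperbolaTime μ) := by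
  have hm := abs_pos.2 hμ
  have hc : Continuous (hyperbolaTime μ) :=
    continuous_iff_continuousAt.2 fun u => (hasDerivAt_hyperbolaTime μ u).continuousAt
  refine hc.surjective ?_ ?_
  · refine tendsto_atTop_mono' _ ?_ (tendsto_id.const_mul_atTop (show 0 < 2 / 3 * |μ| by positivity))
    filter_upwards [eventually_ge_atTop 0] with u hu
    have := Real.self_le_sinh_iff.2 hu
    have := le_abs_self μ
    simp only [hyperbolaTime, id]
    nlinarith
  · refine tendsto_atBot_mono' _ ?_ (tendsto_id.const_mul_atBot (show 0 < 2 / 3 * |μ| by positivity))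
    filter_upwards [eventually_le_atBot 0] with u hu
    have := Real.sinh_le_self_iff.2 hu
    have := le_abs_self μ
    simp only [hyperbolaTime, id]
    nlinarith

/-- The hyperbolic anomaly as a function of time. -/
def hyperbolaAnomaly {μ : ℝ} (hμ : μ ≠ 0) : ℝ ≃o ℝ :=
  ((hyperbolaTime_strictMono hμ).orderIsoOfSurjective _ (hyperbolaTime_surjective hμ)).symm

theorem hasDerivAt_hyperbolaAnomaly {μ : ℝ} (hμ : μ ≠ 0) (t : ℝ) :
    HasDerivAt (hyperbolaAnomaly hμ) (hyperbolaRadius μ (hyperbolaAnomaly hμ t))⁻¹ t :=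
  (hasDerivAt_hyperbolaTime μ _).of_local_left_inverse
    (hyperbolaAnomaly hμ).continuous.continuousAt (hyperbolaRadius_pos hμ _).ne'
    (Eventually.of_forall fun s => (hyperbolaAnomaly hμ).symm_apply_apply s)

/-- The hyperbolic motion, with axes `e₁` and `e₂`. -/
def hyperbola (o e₁ e₂ : Config) (μ u : ℝ) : Phase :=
  (o + ((5 / 3 * |μ| - μ * Real.cosh u) • e₁ + (4 / 3 * |μ| * Real.sinh u) • e₂),
    (-(μ * Real.sinh u) / hyperbolaRadius μ u) • e₁ +
      (4 / 3 * |μ| * Real.cosh u / hyperbolaRadius μ u) • e₂)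

theorem norm_sq_frame {V : Type*} [NormedAddCommGroup V] [InnerProductSpace ℝ V] {e₁ e₂ : V}
    (h₁ : ‖e₁‖ = 1) (h₂ : ‖e₂‖ = 1) (h₁₂ : inner ℝ e₁ e₂ = 0) (x y : ℝ) :
    ‖x • e₁ + y • e₂‖ ^ 2 = x ^ 2 + y ^ 2 := by
  rw [norm_add_sq_real, norm_smul, norm_smul, inner_smul_left, inner_smul_right, h₁, h₂, h₁₂]
  simp

section Frame

variable {o e₁ e₂ : Config} {μ : ℝ}

/-- The semi-axes are |μ| and 4/3 |μ|; eccentricity 5/3 keeps them rational multiples of |μ|. The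
sign of μ selects the attractive or the repulsive branch. -/
theorem norm_hyperbola_sub (h₁ : ‖e₁‖ = 1) (h₂ : ‖e₂‖ = 1) (h₁₂ : inner ℝ e₁ e₂ = 0)
    (hμ : μ ≠ 0) (u : ℝ) : ‖(hyperbola o e₁ e₂ μ u).1 - o‖ = hyperbolaRadius μ u := by
  rw [← sq_eq_sq₀ (norm_nonneg _) (hyperbolaRadius_pos hμ u).le]
  simp only [hyperbola, add_sub_cancel_left]
  rw [norm_sq_frame h₁ h₂ h₁₂, hyperbolaRadius]
  linear_combination (16 / 9 * |μ| ^ 2) * Real.sinh_sq u + (Real.cosh u ^ 2 - 1) * (-sq_abs μ)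

theorem keplerHamiltonian_hyperbola (h₁ : ‖e₁‖ = 1) (h₂ : ‖e₂‖ = 1) (h₁₂ : inner ℝ e₁ e₂ = 0)
    (hμ : μ ≠ 0) (u : ℝ) : keplerHamiltonian o μ (hyperbola o e₁ e₂ μ u) = 1 / 2 := by
  have hR := hyperbolaRadius_pos hμ u
  rw [keplerHamiltonian, dist_eq_norm, norm_hyperbola_sub h₁ h₂ h₁₂ hμ]
  simp only [hyperbola]
  rw [norm_sq_frame h₁ h₂ h₁₂]
  field_simp
  rw [hyperbolaRadius]
  linear_combination 9 * μ ^ 2 * Real.sinh_sq u - 9 * Real.cosh u ^ 2 * sq_abs μ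

theorem hasDerivAt_hyperbolaRadius (μ u : ℝ) :
    HasDerivAt (hyperbolaRadius μ) (5 / 3 * |μ| * Real.sinh u) u :=
  ((Real.hasDerivAt_cosh u).const_mul (5 / 3 * |μ|)).sub_const μ

/-- Since dt/du = r, Hamilton's equations acquire a factor r in the anomaly. -/
theorem hasDerivAt_hyperbola_position (hμ : μ ≠ 0) (u : ℝ) :
    HasDerivAt (fun u => (hyperbola o e₁ e₂ μ u).1)
      (hyperbolaRadius μ u • (hyperbola o e₁ e₂ μ u).2) u := by
  have hR := (hyperbolaRadius_pos hμ u).ne'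
  refine (((((Real.hasDerivAt_cosh u).const_mul μ).const_sub (5 / 3 * |μ|)).smul_const e₁).add
    (((Real.hasDerivAt_sinh u).const_mul (4 / 3 * |μ|)).smul_const e₂)).const_add o
    |>.congr_deriv ?_
  simp only [hyperbola, smul_add, smul_smul, mul_div_cancel₀ _ hR]

theorem hasDerivAt_hyperbola_momentum (hμ : μ ≠ 0) (u : ℝ) :
    HasDerivAt (fun u => (hyperbola o e₁ e₂ μ u).2)
      (-(μ / hyperbolaRadius μ u ^ 2) • ((hyperbola o e₁ e₂ μ u).1 - o)) u := by
  have hR := (hyperbolaRadius_pos hμ u).ne'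
  have hd := hasDerivAt_hyperbolaRadius μ u
  refine (((((Real.hasDerivAt_sinh u).const_mul μ).neg.div hd hR).smul_const e₁).add
    ((((Real.hasDerivAt_cosh u).const_mul (4 / 3 * |μ|)).div hd hR).smul_const e₂)).congr_deriv ?_
  simp only [hyperbola, add_sub_cancel_left, smul_add, smul_smul, Pi.neg_apply]
  have hs := Real.sinh_sq u
  congr 2
  · field_simp
    rw [hyperbolaRadius]
    linear_combination 5 * |μ| * hs
  · field_simp
    rw [hyperbolaRadius]
    ring

theorem tendsto_hyperbolaRadius (hμ : μ ≠ 0) {l : Filter ℝ}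
    (hl : Tendsto Real.cosh l atTop) : Tendsto (hyperbolaRadius μ) l atTop :=
  tendsto_atTop_mono (hyperbolaRadius_ge μ)
    (hl.const_mul_atTop (by have := abs_pos.2 hμ; positivity))

theorem tendsto_cosh_atTop : Tendsto Real.cosh atTop atTop := by
  refine tendsto_atTop_mono (fun u => ?_) (Real.tendsto_exp_atTop.const_mul_atTop
    (show (0 : ℝ) < 1 / 2 by norm_num))
  rw [Real.cosh_eq]
  linarith [Real.exp_pos (-u)]

theorem tendsto_cosh_atBot : Tendsto Real.cosh atBot atTop :=
  (tendsto_cosh_atTop.comp tendsto_neg_atBot_atTop).congr Real.cosh_neg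

theorem tendsto_tanh_atTop : Tendsto Real.tanh atTop (𝓝 1) := by
  -- 1 - tanh u = exp(-u) / cosh u.
  have h1 := (Real.tendsto_exp_atBot.comp tendsto_neg_atTop_atBot).mul
    tendsto_cosh_atTop.inv_tendsto_atTop
  have h2 := h1.const_sub 1
  simp only [mul_zero, sub_zero] at h2
  refine h2.congr fun u => ?_
  have hc := (Real.cosh_pos u).ne'
  simp only [Function.comp, Pi.inv_apply, Real.tanh_eq_sinh_div_cosh, ← Real.cosh_sub_sinh]
  field_simp
  ring

theorem tendsto_tanh_atBot : Tendsto Real.tanh atBot (𝓝 (-1)) :=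
  (tendsto_tanh_atTop.comp tendsto_neg_atBot_atTop).neg.congr fun u => by simp [Real.tanh_neg]

/-- The radius stays positive, so no collision occurs and the collision clauses are vacuous. -/
theorem isScatteringTrajectory_hyperbola (h₁ : ‖e₁‖ = 1) (h₂ : ‖e₂‖ = 1)
    (h₁₂ : inner ℝ e₁ e₂ = 0) (hμ : μ ≠ 0) :
    IsScatteringTrajectory (keplerHamiltonian o μ)
      (fun t => hyperbola o e₁ e₂ μ (hyperbolaAnomaly hμ t)) := by
  have hR := hyperbolaRadius_pos hμ
  have hreg : ∀ u, (hyperbola o e₁ e₂ μ u).1 ∉ singularPositions (keplerHamiltonian o μ) := by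
    intro u hmem
    have := norm_hyperbola_sub (o := o) h₁ h₂ h₁₂ hμ u
    rw [position_eq_center hmem, sub_self, norm_zero] at this
    exact (hR u).ne this
  have hne : ∀ u, (hyperbola o e₁ e₂ μ u).1 ≠ o := fun u => position_ne_center (hreg u) hμ
  have hpos : ∀ t, HasDerivAt (fun t => (hyperbola o e₁ e₂ μ (hyperbolaAnomaly hμ t)).1)
      (hyperbola o e₁ e₂ μ (hyperbolaAnomaly hμ t)).2 t := by
    intro t
    refine ((hasDerivAt_hyperbola_position hμ _).scomp t
      (hasDerivAt_hyperbolaAnomaly hμ t)).congr_deriv ?_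
    rw [smul_smul, inv_mul_cancel₀ (hR _).ne', one_smul]
  have hrad : ∀ l : Filter ℝ, Tendsto (fun t => Real.cosh (hyperbolaAnomaly hμ t)) l atTop →
      Tendsto (fun t => ‖(hyperbola o e₁ e₂ μ (hyperbolaAnomaly hμ t)).1‖) l atTop := by
    intro l hl
    have := tendsto_norm_sub_atTop (o := o)
      (q := fun t => (hyperbola o e₁ e₂ μ (hyperbolaAnomaly hμ t)).1) (l := l) ?_ 0
    · simpa using this
    · simp only [norm_hyperbola_sub h₁ h₂ h₁₂ hμ]
      exact (tendsto_hyperbolaRadius hμ (l := l.map (hyperbolaAnomaly hμ)) hl)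
  refine ⟨⟨?_, fun t _ => ?_, fun t _ => ?_, fun t ht => absurd ht (hreg _), fun s t _ _ => ?_,
    fun t ht => absurd ht (hreg _)⟩, fun t _ => ?_, ?_, ?_⟩
  · exact continuous_iff_continuousAt.2 fun t => (hpos t).continuousAt
  · rw [gradient_kepler_momentum]
    exact hpos t
  · rw [gradient_kepler_position _ _ _ _ fun _ => hne _]
    refine ((hasDerivAt_hyperbola_momentum hμ _).scomp t
      (hasDerivAt_hyperbolaAnomaly hμ t)).congr_deriv ?_
    rw [norm_hyperbola_sub h₁ h₂ h₁₂ hμ, smul_smul, ← neg_smul]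
    congr 1
    have := (hR (hyperbolaAnomaly hμ t)).ne'
    field_simp
  · simp only [keplerHamiltonian_hyperbola h₁ h₂ h₁₂ hμ]
  · rw [keplerHamiltonian_hyperbola h₁ h₂ h₁₂ hμ]
    norm_num
  · rintro ⟨R, hB⟩
    obtain ⟨t, ht, ht0⟩ := (((hrad atTop (tendsto_cosh_atTop.comp
      (hyperbolaAnomaly hμ).tendsto_atTop)).eventually_gt_atTop R).and
        (eventually_ge_atTop 0)).exists
    exact ht.not_ge (hB ⟨t, ht0, rfl⟩)
  · rintro ⟨R, hB⟩
    obtain ⟨t, ht, ht0⟩ := (((hrad atBot (tendsto_cosh_atBot.comp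
      (hyperbolaAnomaly hμ).tendsto_atBot)).eventually_gt_atTop R).and
        (eventually_le_atBot 0)).exists
    exact ht.not_ge (hB ⟨t, ht0, rfl⟩)

theorem tendsto_integralMap_hyperbola (a μ₁ μ₂ : ℝ) (h₁ : ‖e₁‖ = 1) (h₂ : ‖e₂‖ = 1)
    (h₁₂ : inner ℝ e₁ e₂ = 0) (hμ : μ ≠ 0) {l : Filter ℝ} {s : ℝ}
    (hc : Tendsto Real.cosh l atTop) (hs : Tendsto Real.tanh l (𝓝 s)) :
    Tendsto (fun u => integralMap a μ₁ μ₂ (hyperbola o e₁ e₂ μ u)) l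
      (𝓝 (asymptoticValue a μ₁ μ₂ o
        ((-(μ * s) / (5 / 3 * |μ|)) • e₁ + (4 / 3 * |μ| / (5 / 3 * |μ|)) • e₂)
        (-μ / (5 / 3 * |μ|) * e₁ 2 + 4 / 3 * |μ| * s / (5 / 3 * |μ|) * e₂ 2)
        fun i j => 4 / 3 * |μ| * (e₁ i * e₂ j - e₁ j * e₂ i))) := by
  have hm := abs_pos.2 hμ
  have hR := hyperbolaRadius_pos hμ
  have hi : Tendsto (fun u => (Real.cosh u)⁻¹) l (𝓝 0) := hc.inv_tendsto_atTop
  have hden : Tendsto (fun u => 5 / 3 * |μ| - μ * (Real.cosh u)⁻¹) l (𝓝 (5 / 3 * |μ|)) := by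
    simpa using (hi.const_mul μ).const_sub (5 / 3 * |μ|)
  have hm' : 5 / 3 * |μ| ≠ 0 := by positivity
  -- Numerator and radius are compared after division by cosh u; the two ends then differ only
  -- through s = ±1, the limit of tanh.
  have hquot : ∀ (f : ℝ → ℝ) (x : ℝ), Tendsto (fun u => f u / Real.cosh u) l (𝓝 x) →
      Tendsto (fun u => f u / hyperbolaRadius μ u) l (𝓝 (x / (5 / 3 * |μ|))) := by
    intro f x hf
    refine (hf.div hden hm').congr fun u => ?_
    have hcu := (Real.cosh_pos u).ne'
    have e : 5 / 3 * |μ| - μ * (Real.cosh u)⁻¹ = hyperbolaRadius μ u / Real.cosh u := by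
      rw [hyperbolaRadius]
      field_simp
    simp only [Pi.div_apply]
    rw [e, div_div_div_cancel_right₀ hcu]
  have hsinh : ∀ k : ℝ, Tendsto (fun u => k * Real.sinh u / Real.cosh u) l (𝓝 (k * s)) := by
    intro k
    refine (hs.const_mul k).congr fun u => ?_
    rw [Real.tanh_eq_sinh_div_cosh, mul_div_assoc]
  have hcosh : ∀ k : ℝ, Tendsto (fun u => k * Real.cosh u / Real.cosh u) l (𝓝 k) := by
    intro k
    refine tendsto_const_nhds.congr fun u => ?_
    rw [mul_div_cancel_right₀ _ (Real.cosh_pos u).ne']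
  have hX : Tendsto (fun u => (5 / 3 * |μ| - μ * Real.cosh u) / Real.cosh u) l (𝓝 (-μ)) := by
    have := (hi.const_mul (5 / 3 * |μ|)).sub (hcosh μ)
    rw [mul_zero, zero_sub] at this
    refine this.congr fun u => ?_
    rw [sub_div, div_eq_mul_inv (5 / 3 * |μ|)]
  refine tendsto_integralMap a μ₁ μ₂ ?_ ?_ ?_ fun i j => ?_
  · simp only [norm_hyperbola_sub h₁ h₂ h₁₂ hμ]
    exact tendsto_hyperbolaRadius hμ hc
  · have h1 := hquot _ _ (hsinh (-μ))
    simp only [neg_mul] at h1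
    exact (h1.smul_const e₁).add ((hquot _ _ (hcosh (4 / 3 * |μ|))).smul_const e₂)
  · simp only [norm_hyperbola_sub h₁ h₂ h₁₂ hμ]
    refine (((hquot _ _ hX).mul_const (e₁ 2)).add
      ((hquot _ _ (hsinh (4 / 3 * |μ|))).mul_const (e₂ 2))).congr fun u => ?_
    simp [hyperbola]
    ring
  · refine tendsto_const_nhds.congr fun u => ?_
    have hs := Real.sinh_sq u
    have := (hR u).ne'
    simp [hyperbola]
    field_simp
    rw [hyperbolaRadius]
    linear_combination (-12) * |μ| * (e₁ i * e₂ j - e₁ j * e₂ i) * μ * hs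

theorem asymptoticValue_eq_of_isReference {a μ₁ μ₂ : ℝ} (h₁ : ‖e₁‖ = 1) (h₂ : ‖e₂‖ = 1)
    (h₁₂ : inner ℝ e₁ e₂ = 0) (hμ : μ ≠ 0)
    (h : IsReference (integralMap a μ₁ μ₂) (keplerHamiltonian o μ)) :
    asymptoticValue a μ₁ μ₂ o
        ((-(μ * 1) / (5 / 3 * |μ|)) • e₁ + (4 / 3 * |μ| / (5 / 3 * |μ|)) • e₂)
        (-μ / (5 / 3 * |μ|) * e₁ 2 + 4 / 3 * |μ| * 1 / (5 / 3 * |μ|) * e₂ 2)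
        (fun i j => 4 / 3 * |μ| * (e₁ i * e₂ j - e₁ j * e₂ i)) =
      asymptoticValue a μ₁ μ₂ o
        ((-(μ * -1) / (5 / 3 * |μ|)) • e₁ + (4 / 3 * |μ| / (5 / 3 * |μ|)) • e₂)
        (-μ / (5 / 3 * |μ|) * e₁ 2 + 4 / 3 * |μ| * -1 / (5 / 3 * |μ|) * e₂ 2)
        (fun i j => 4 / 3 * |μ| * (e₁ i * e₂ j - e₁ j * e₂ i)) := by
  obtain ⟨c, hc₁, hc₂⟩ := h _ (isScatteringTrajectory_hyperbola h₁ h₂ h₁₂ hμ)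
  have h1 := (tendsto_integralMap_hyperbola (o := o) a μ₁ μ₂ h₁ h₂ h₁₂ hμ tendsto_cosh_atTop
    tendsto_tanh_atTop).comp (hyperbolaAnomaly hμ).tendsto_atTop
  have h2 := (tendsto_integralMap_hyperbola (o := o) a μ₁ μ₂ h₁ h₂ h₁₂ hμ tendsto_cosh_atBot
    tendsto_tanh_atBot).comp (hyperbolaAnomaly hμ).tendsto_atBot
  exact (tendsto_nhds_unique h1 hc₁).trans (tendsto_nhds_unique hc₂ h2)

end Frame

end

/-! ### Necessity -/

/-- In the xz- and yz-planes, `L_z` detects the offset of `o` perpendicular to the plane. With `o`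
on the axis, `G` in the xz-plane gives the linear relation. There p_x² agrees at both ends, so the
coefficient `o 2 ^ 2 - a ^ 2` only shows up on the tilted hyperbola. -/
theorem center_eq_of_isReference {a μ₁ μ₂ μ : ℝ} {o : Config} (hμ : μ ≠ 0)
    (h : IsReference (integralMap a μ₁ μ₂) (keplerHamiltonian o μ)) :
    o 0 = 0 ∧ o 1 = 0 ∧ o 2 * μ + a * (μ₁ - μ₂) = 0 ∧ o 2 ^ 2 = a ^ 2 := by
  have hm := abs_pos.2 hμ
  have hxz := asymptoticValue_eq_of_isReference (e₁ := !₂[1, 0, 0]) (e₂ := !₂[0, 0, 1])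
    (by simp [EuclideanSpace.norm_eq, Fin.sum_univ_three])
    (by simp [EuclideanSpace.norm_eq, Fin.sum_univ_three])
    (by simp [PiLp.inner_apply, Fin.sum_univ_three]) hμ h
  have hyz := asymptoticValue_eq_of_isReference (e₁ := !₂[0, 1, 0]) (e₂ := !₂[0, 0, 1])
    (by simp [EuclideanSpace.norm_eq, Fin.sum_univ_three])
    (by simp [EuclideanSpace.norm_eq, Fin.sum_univ_three])
    (by simp [PiLp.inner_apply, Fin.sum_univ_three]) hμ h
  have htilt := asymptoticValue_eq_of_isReference (e₁ := !₂[4 / 5, 0, 3 / 5])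
    (e₂ := !₂[-(3 / 5), 0, 4 / 5])
    (by rw [EuclideanSpace.norm_eq]; simp [Fin.sum_univ_three]; norm_num)
    (by rw [EuclideanSpace.norm_eq]; simp [Fin.sum_univ_three]; norm_num)
    (by simp [PiLp.inner_apply, Fin.sum_univ_three]; norm_num) hμ h
  have e : 4 / 3 * |μ| / (5 / 3 * |μ|) = 4 / 5 := by field_simp
  -- κ is ±3/5 according to the sign of μ; only κ ≠ 0 is needed, so no case distinction arises.
  obtain ⟨κ, hκ⟩ : ∃ κ, μ / (5 / 3 * |μ|) = κ := ⟨_, rfl⟩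
  have hκ0 : κ ≠ 0 := by rw [← hκ]; positivity
  have hμκ : μ = κ * (5 / 3 * |μ|) := by rw [← hκ]; field_simp
  simp only [asymptoticValue, norm_sq_coord, mul_neg, mul_one, neg_neg, e, neg_div, hκ,
    Prod.mk.injEq, PiLp.add_apply, PiLp.smul_apply, smul_eq_mul, Matrix.cons_val] at hxz hyz htilt
  have o0 : o 0 = 0 := mul_left_cancel₀ hκ0 (by linear_combination -hyz.2.1 / 2)
  have o1 : o 1 = 0 := mul_left_cancel₀ hκ0 (by linear_combination hxz.2.1 / 2)
  have hz := hxz.2.2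
  have ht := htilt.2.2
  rw [o0, o1] at hz ht
  have hc : o 2 * μ + a * (μ₁ - μ₂) = 0 := by linear_combination 5 / 8 * hz + o 2 * hμκ
  refine ⟨o0, o1, hc, mul_left_cancel₀ hκ0 ?_⟩
  linear_combination 125 / 96 * (ht - 32 / 25 * hc + 32 / 25 * o 2 * hμκ)

/-- The motion along the `z`-axis under the free Hamiltonian. -/
theorem isScatteringTrajectory_line (o : Config) :
    IsScatteringTrajectory (keplerHamiltonian o 0)
      (fun t => (t • !₂[0, 0, 1], !₂[0, 0, 1])) := by
  have hn : ‖(!₂[0, 0, 1] : Config)‖ = 1 := by simp [EuclideanSpace.norm_eq, Fin.sum_univ_three]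
  have hreg : ∀ q, q ∉ singularPositions (keplerHamiltonian o 0) := by
    rintro q ⟨p, hp⟩
    apply hp
    have : keplerHamiltonian o 0 = fun x => ‖x.2‖ ^ 2 / 2 := by
      funext x; simp [keplerHamiltonian]
    rw [this]
    exact (contDiffAt_snd.norm_sq ℝ).div_const 2
  refine ⟨⟨by fun_prop, fun t _ => ?_, fun t _ => ?_, fun t ht => absurd ht (hreg _),
    fun s t _ _ => ?_, fun t ht => absurd ht (hreg _)⟩, fun t _ => ?_, ?_, ?_⟩
  · rw [gradient_kepler_momentum]
    simpa using (hasDerivAt_id t).smul_const (!₂[0, 0, 1] : Config)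
  · rw [gradient_kepler_position _ _ _ _ (by simp)]
    simpa using hasDerivAt_const t (!₂[0, 0, 1] : Config)
  · simp [keplerHamiltonian]
  · simp [keplerHamiltonian, hn]
  · rintro ⟨R, hB⟩
    have := hB ⟨|R| + 1, Set.mem_Ici.2 (by positivity), rfl⟩
    simp only [norm_smul, hn, Real.norm_eq_abs, mul_one] at this
    linarith [le_abs_self R, le_abs_self (|R| + 1)]
  · rintro ⟨R, hB⟩
    have := hB ⟨-(|R| + 1), Set.mem_Iic.2 (neg_nonpos.2 (by positivity)), rfl⟩
    simp only [norm_smul, hn, Real.norm_eq_abs, mul_one, abs_neg] at this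
    linarith [le_abs_self R, le_abs_self (|R| + 1)]

theorem eq_of_isReference_free {a μ₁ μ₂ : ℝ} {o : Config} (ha : 0 < a)
    (h : IsReference (integralMap a μ₁ μ₂) (keplerHamiltonian o 0)) : μ₁ = μ₂ := by
  obtain ⟨c, hc₁, hc₂⟩ := h _ (isScatteringTrajectory_line o)
  have hn : ‖(!₂[0, 0, 1] : Config)‖ = 1 := by simp [EuclideanSpace.norm_eq, Fin.sum_univ_three]
  -- The free motion ignores `o`, so the origin serves as base point: the angular momentum is 0 and
  -- the direction is the sign of t.
  have key : ∀ (l : Filter ℝ) (s : ℝ), Tendsto (fun t : ℝ => |t|) l atTop →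
      (∀ᶠ t in l, s = t / |t|) →
      Tendsto (fun t : ℝ => integralMap a μ₁ μ₂ (t • !₂[0, 0, 1], !₂[0, 0, 1])) l
        (𝓝 (asymptoticValue a μ₁ μ₂ 0 !₂[0, 0, 1] s fun _ _ => 0)) := by
    intro l s habs hs
    refine tendsto_integralMap a μ₁ μ₂ ?_ tendsto_const_nhds ?_ fun i j => ?_
    · simpa [norm_smul, hn] using habs
    · refine tendsto_const_nhds.congr' ?_
      filter_upwards [hs] with t ht
      simpa [norm_smul, hn] using ht
    · refine tendsto_const_nhds.congr fun t => ?_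
      simp only [PiLp.smul_apply, smul_eq_mul, PiLp.zero_apply]
      ring
  have h1 := key atTop 1 tendsto_abs_atTop_atTop (by
    filter_upwards [eventually_gt_atTop 0] with t ht
    rw [abs_of_pos ht, div_self ht.ne'])
  have h2 := key atBot (-1) tendsto_abs_atBot_atTop (by
    filter_upwards [eventually_lt_atBot 0] with t ht
    rw [abs_of_neg ht, div_neg, div_self ht.ne])
  have h3 := congrArg (fun x => x.2.2)
    ((tendsto_nhds_unique h1 hc₁).trans (tendsto_nhds_unique hc₂ h2))
  simp only [asymptoticValue] at h3
  have h4 : a * (μ₁ - μ₂) = 0 := by linear_combination h3 / 2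
  exact sub_eq_zero.1 ((mul_eq_zero.1 h4).resolve_left ha.ne')

/-! ### Characterization of the reference Hamiltonians -/

theorem keplerHamiltonian_zero (o : Config) : keplerHamiltonian o 0 = freeHamiltonian := by
  funext x
  simp [keplerHamiltonian, freeHamiltonian]

theorem isReference_kepler_iff {a μ₁ μ₂ : ℝ} (ha : 0 < a) (o : Config) (μ : ℝ) :
    IsReference (integralMap a μ₁ μ₂) (keplerHamiltonian o μ) ↔
      keplerHamiltonian o μ = keplerHamiltonian (center₁ a) (μ₁ - μ₂) ∨
        keplerHamiltonian o μ = keplerHamiltonian (center₂ a) (μ₂ - μ₁) := by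
  constructor
  · intro h
    by_cases hμ : μ = 0
    · subst hμ
      have := eq_of_isReference_free ha h
      left
      -- For zero charge the centers may differ while the Hamiltonians coincide, hence the equality
      -- of functions in the statement.
      rw [this, sub_self, keplerHamiltonian_zero, keplerHamiltonian_zero]
    obtain ⟨o0, o1, hc, h2⟩ := center_eq_of_isReference hμ h
    rcases sq_eq_sq_iff_eq_or_eq_neg.1 h2 with h2 | h2
    · right
      congr 1
      · ext i
        fin_cases i <;> simp [center₂, o0, o1, h2]
      · rw [h2] at hc
        refine mul_left_cancel₀ ha.ne' ?_
        linear_combination hc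
    · left
      congr 1
      · ext i
        fin_cases i <;> simp [center₁, o0, o1, h2]
      · rw [h2] at hc
        refine mul_left_cancel₀ ha.ne' ?_
        linear_combination -hc
  · rintro (h | h) <;> rw [h]
    · exact isReference_of_axis (by ring) (by ring)
    · exact isReference_of_axis (by ring) (by ring)

theorem isReference_free_iff {a μ₁ μ₂ : ℝ} (ha : 0 < a) :
    IsReference (integralMap a μ₁ μ₂) freeHamiltonian ↔ μ₁ = μ₂ := by
  rw [← keplerHamiltonian_zero (center₁ a)]
  refine ⟨eq_of_isReference_free ha, fun h => ?_⟩
  rw [isReference_kepler_iff ha, h, sub_self]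
  exact Or.inl rfl

end TwoCenter

theorem mainTheorem2 (a μ₁ μ₂ : ℝ) (ha : 0 < a) :
    (∀ (o : TwoCenter.Config) (μ : ℝ),
      TwoCenter.IsReference (TwoCenter.integralMap a μ₁ μ₂) (TwoCenter.keplerHamiltonian o μ) ↔
        (TwoCenter.keplerHamiltonian o μ =
            TwoCenter.keplerHamiltonian (TwoCenter.center₁ a) (μ₁ - μ₂) ∨
          TwoCenter.keplerHamiltonian o μ =
            TwoCenter.keplerHamiltonian (TwoCenter.center₂ a) (μ₂ - μ₁))) ∧
    (TwoCenter.IsReference (TwoCenter.integralMap a μ₁ μ₂) TwoCenter.freeHamiltonian ↔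
      μ₁ = μ₂) :=
  ⟨TwoCenter.isReference_kepler_iff ha, TwoCenter.isReference_free_iff ha⟩
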